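/- Work in monomodal propositional logic with countably many atoms and primitives $\top,\neg,\vee,\lozenge$, where $\Box=\neg\lozenge\neg$. A normal logic contains all propositional tautologies, $\Box(p\to q)\to(\Box p\to\Box q)$ and $\lozenge p\leftrightarrow\neg\Box\neg p$, and is closed under modus ponens, generalisation and substitution. It is Kripke complete if it contains every formula that is valid in all the Kripke frames validating it. Let $4=\lozenge\lozenge p\to\lozenge p$, $T=p\to\lozenge p$ and $U_n=\bigvee_{i\le n}\Box\big(\Box q_i\to\bigvee_{j\le n,\,j\ne i}\Box q_j\big)$. A normal logic has finite achronal width if it contains $U_n$ for some $n\ge 1$. Let $K4U_n$ be the smallest normal logic containing $4$ and $U_n$. Let $\varphi\mapsto\varphi^\circ$ be the translation that fixes atoms and $\top$, commutes with $\neg$ and $\vee$, and satisfies $(\lozenge\varphi)^\circ=\varphi^\circ\vee\lozenge(\varphi^\circ)$. Let $p_0,p_1,q_0,q_1,r_0,r_1,s,t$ be distinct atoms. Put $B_0=q_0$, $B_1=q_1$, $C_0=r_0$, $C_1=r_1$, and for $m\ge 0$ $$B_{m+2}=\lozenge B_{m+1}\wedge\lozenge C_m\wedge\neg\lozenge C_{m+1},\qquad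 C_{m+2}=\lozenge C_{m+1}\wedge\lozenge B_m\wedge\neg\lozenge B_{m+1},$$ $$A_m=\neg\lozenge p_0\wedge\lozenge B_{m+1}\wedge\lozenge C_{m+1}\wedge\neg\lozenge B_{m+2}\wedge\neg\lozenge C_{m+2}.$$ Let $E$ be the conjunction of $\lozenge p_0$, $\Box(p_0\to\lozenge p_1)$, $\Box(p_1\to\lozenge p_0)$, $\Box\neg(p_0\wedge p_1)$, $\Box(q_1\to\lozenge q_0\wedge\neg\lozenge r_0)$, $\Box(r_1\to\lozenge r_0\wedge\neg\lozenge q_0)$, $\Box(q_0\to\neg\lozenge q_1)$, $\Box(r_0\to\neg\lozenge r_1)$ and $\lozenge A_0$. Let $$G=E\to\lozenge\big(\lozenge p_0\wedge\neg\lozenge A_0\wedge\lozenge A_1\big),$$ $$H=\neg\big(s\wedge\Box(s\to\lozenge(\neg s\wedge t\wedge\lozenge(\neg s\wedge\neg t\wedge\lozenge s)))\big).$$ These formulas of Fine's kind witness the incompleteness of $S4GH$, the smallest normal logic containing $T,4,G,H$: every frame validating $S4GH$ validates $\neg E$, yet $\neg E\notin S4GH$. Moreover, let $K4U_2G^\circ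 H^\circ$ be the smallest normal logic containing $4$, $U_2$, $G^\circ$ and $H^\circ$. Then: 1. $K4U_2G^\circ H^\circ$ is a normal extension of $K4U_2$, and so of finite achronal width. 2. Every frame validating $K4U_2G^\circ H^\circ$ validates $\neg E^\circ$. 3. $\neg E^\circ\notin K4U_2G^\circ H^\circ$. 4. Hence $K4U_2G^\circ H^\circ$ is Kripke incomplete. Consequently it is not the case that every normal logic of finite achronal width that contains $4$ is Kripke complete, so Fine's completeness theorem for finite-width logics does not extend to finite achronal width. -/

import Mathlib

universe u

namespace ModalLogic

/-- Monomodal formulas over the atoms `q 0, q 1, q 2, …`; the primitives are `⊤, ¬, ∨, ◇`. -/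
inductive Form : Type where
  | atom : ℕ → Form
  | top : Form
  | neg : Form → Form
  | or : Form → Form → Form
  | dia : Form → Form

namespace Form

def bot : Form := neg top
def and (φ ψ : Form) : Form := neg (or (neg φ) (neg ψ))
def imp (φ ψ : Form) : Form := or (neg φ) ψ
def iff (φ ψ : Form) : Form := and (imp φ ψ) (imp ψ φ)
def box (φ : Form) : Form := neg (dia (neg φ))

/-- Finite disjunction. -/
def disj : List Form → Form
  | [] => bot
  | φ :: l => or φ (disj l)

/-- Finite conjunction. -/
def conj : List Form → Form
  | [] => top
  | φ :: l => and φ (conj l)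

/-- Uniform substitution of formulas for atoms. -/
def subst (σ : ℕ → Form) : Form → Form
  | atom i => σ i
  | top => top
  | neg φ => neg (subst σ φ)
  | or φ ψ => or (subst σ φ) (subst σ ψ)
  | dia φ => dia (subst σ φ)

/-- The reflexive-closure translation `φ ↦ φ°`: it commutes with the Boolean connectives and
`(◇φ)° = φ° ∨ ◇(φ°)`. -/
def circ : Form → Form
  | atom i => atom i
  | top => top
  | neg φ => neg (circ φ)
  | or φ ψ => or (circ φ) (circ ψ)
  | dia φ => or (circ φ) (dia (circ φ))

/-- `φ` is a propositional tautology: it is true under every Boolean truth assignment to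
formulas, atoms and formulas `◇ψ` being assigned arbitrary values. -/
def IsTautology (φ : Form) : Prop :=
  ∀ v : Form → Prop, v top → (∀ ψ, v (neg ψ) ↔ ¬ v ψ) →
    (∀ ψ χ, v (or ψ χ) ↔ (v ψ ∨ v χ)) → v φ

end Form

open Form

/-! ### Kripke semantics -/

/-- A (monomodal) Kripke frame. -/
structure Frame : Type (u + 1) where
  W : Type u
  R : W → W → Prop

/-- Truth at a point of the model on `F` with valuation `V`. -/
def Truth (F : Frame.{u}) (V : ℕ → Set F.W) : F.W → Form → Prop
  | w, .atom i => w ∈ V i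
  | _, .top => True
  | w, .neg φ => ¬ Truth F V w φ
  | w, .or φ ψ => Truth F V w φ ∨ Truth F V w ψ
  | w, .dia φ => ∃ y, F.R w y ∧ Truth F V y φ

/-- The frame `F` validates the formula `φ`. -/
def Frame.Validates (F : Frame.{u}) (φ : Form) : Prop :=
  ∀ (V : ℕ → Set F.W) (w : F.W), Truth F V w φ

/-- The frame `F` validates every formula of `Γ`. -/
def Frame.ValidatesAll (F : Frame.{u}) (Γ : Set Form) : Prop :=
  ∀ φ ∈ Γ, F.Validates φ

/-! ### Normal logics -/

/-- Normal modal logics (with `◇` primitive, `p` and `q` are distinct atoms). -/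
structure IsNormalLogic (L : Set Form) : Prop where
  taut : ∀ φ : Form, φ.IsTautology → φ ∈ L
  axiomK : imp (box (imp (atom 0) (atom 1))) (imp (box (atom 0)) (box (atom 1))) ∈ L
  axiomDual : iff (dia (atom 0)) (neg (box (neg (atom 0)))) ∈ L
  mp : ∀ φ ψ : Form, imp φ ψ ∈ L → φ ∈ L → ψ ∈ L
  gen : ∀ φ : Form, φ ∈ L → box φ ∈ L
  subst : ∀ (φ : Form) (σ : ℕ → Form), φ ∈ L → φ.subst σ ∈ L

/-- The smallest normal modal logic containing `Γ`. -/
def normalClosure (Γ : Set Form) : Set Form :=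
  {φ | ∀ L : Set Form, IsNormalLogic L → Γ ⊆ L → φ ∈ L}

/-- `L` is Kripke complete: every formula valid in all the frames that validate `L` is in `L`. -/
def KripkeComplete (L : Set Form) : Prop :=
  ∀ φ : Form, (∀ F : Frame.{u}, F.ValidatesAll L → F.Validates φ) → φ ∈ L

/-- The axiom `4`, that is `◇◇p → ◇p`. -/
def ax4 : Form := imp (dia (dia (atom 0))) (dia (atom 0))

/-- The axiom `T`, that is `p → ◇p`. -/
def axT : Form := imp (atom 0) (dia (atom 0))

/-- The axiom `U n`, that is `⋁_{i ≤ n} □(□q_i → ⋁_{j ≤ n, j ≠ i} □q_j)`. -/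
def axU (n : ℕ) : Form :=
  disj ((List.range (n + 1)).map fun i =>
    box (imp (box (atom i))
      (disj (((List.range (n + 1)).filter (fun j => j ≠ i)).map fun j => box (atom j)))))

/-- The logic `K4U_n`. -/
def K4U (n : ℕ) : Set Form := normalClosure {ax4, axU n}

/-- A normal logic of finite achronal width. -/
def FiniteAchronalWidth (L : Set Form) : Prop :=
  IsNormalLogic L ∧ ∃ n : ℕ, 0 < n ∧ axU n ∈ L

/-! ### The formulas `E`, `G`, `H` -/

def p0 : Form := atom 0
def p1 : Form := atom 1
def q0 : Form := atom 2
def q1 : Form := atom 3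
def r0 : Form := atom 4
def r1 : Form := atom 5
def s : Form := atom 6
def t : Form := atom 7

/-- `B 0 = q₀`, `B 1 = q₁`, `B (m+2) = ◇B(m+1) ∧ ◇C m ∧ ¬◇C(m+1)` (first component) and
`C 0 = r₀`, `C 1 = r₁`, `C (m+2) = ◇C(m+1) ∧ ◇B m ∧ ¬◇B(m+1)` (second component). -/
def fineBC : ℕ → Form × Form
  | 0 => (q0, r0)
  | 1 => (q1, r1)
  | m + 2 =>
    (conj [dia (fineBC (m + 1)).1, dia (fineBC m).2, neg (dia (fineBC (m + 1)).2)],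
     conj [dia (fineBC (m + 1)).2, dia (fineBC m).1, neg (dia (fineBC (m + 1)).1)])

def fineB (m : ℕ) : Form := (fineBC m).1
def fineC (m : ℕ) : Form := (fineBC m).2

/-- `A m = ¬◇p₀ ∧ ◇B(m+1) ∧ ◇C(m+1) ∧ ¬◇B(m+2) ∧ ¬◇C(m+2)`. -/
def fineA (m : ℕ) : Form :=
  conj [neg (dia p0), dia (fineB (m + 1)), dia (fineC (m + 1)),
    neg (dia (fineB (m + 2))), neg (dia (fineC (m + 2)))]

/-- The conjunction of
`◇p₀`, `□(p₀ → ◇p₁)`, `□(p₁ → ◇p₀)`, `□¬(p₀ ∧ p₁)`,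
`□(q₁ → ◇q₀ ∧ ¬◇r₀)`, `□(r₁ → ◇r₀ ∧ ¬◇q₀)`, `□(q₀ → ¬◇q₁)`, `□(r₀ → ¬◇r₁)` and `◇A 0`. -/
def fineE : Form :=
  conj [dia p0,
    box (imp p0 (dia p1)), box (imp p1 (dia p0)), box (neg (and p0 p1)),
    box (imp q1 (and (dia q0) (neg (dia r0)))),
    box (imp r1 (and (dia r0) (neg (dia q0)))),
    box (imp q0 (neg (dia q1))), box (imp r0 (neg (dia r1))),
    dia (fineA 0)]

/-- `G = E → ◇(◇p₀ ∧ ¬◇A 0 ∧ ◇A 1)`. -/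
def fineG : Form :=
  imp fineE (dia (conj [dia p0, neg (dia (fineA 0)), dia (fineA 1)]))

/-- `H = ¬(s ∧ □(s → ◇(¬s ∧ t ∧ ◇(¬s ∧ ¬t ∧ ◇s))))`. -/
def fineH : Form :=
  neg (and s (box (imp s (dia (conj [neg s, t,
    dia (conj [neg s, neg t, dia s])])))))

/-- The logic `S4GH`. -/
def S4GH : Set Form := normalClosure {axT, ax4, fineG, fineH}

/-- The logic `K4U_2G°H°`. -/
def K4U2GHcirc : Set Form := normalClosure {ax4, axU 2, fineG.circ, fineH.circ}

end ModalLogic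

open ModalLogic

namespace ModalLogic

open Form

/-! ### Truth and the defined connectives -/

section Truth

variable {F : Frame.{u}} {V : ℕ → Set F.W} {x : F.W} {φ ψ : Form}

/-! Let E hold at a point of a reflexive transitive frame validating G and H. By G a later point
sees p₀ and A 1 but not A 0. Re-evaluating q₀, q₁, r₀, r₁ as B 1, B 2, C 1, C 2 turns A 1 into A 0
and restores E there, so G applies again (`exists_truth_fineE_shift`). The resulting infinite path
never repeats, and on such a path s and t can be placed so as to refute H. By `truth_circ` the
argument reaches K4U_2G°H° through reflexive closures.

For non-membership, take a general frame whose admissible sets are eventually constant along an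
infinite chain. They cannot alternate along it forever, and the cluster has only two points, so H
holds (`not_cycle`); likewise the alternating p₀, p₁ of E force a p₀-point into the cluster
(`alternating`). E also pins B 1, B 2, B 3 and C 1, C 2, C 3 to opposite `side` points of equal
index and A 0 to one `join n`, so `spine (n + 1)` witnesses G. The `join` points are an infinite
antichain, but their proper successor sets are nested: U_2 holds for the irreflexive relation, while
° reads G and H in its reflexive closure. -/

@[simp] theorem truth_atom {i : ℕ} : Truth F V x (.atom i) ↔ x ∈ V i := Iff.rfl

@[simp] theorem truth_neg : Truth F V x (.neg φ) ↔ ¬ Truth F V x φ := Iff.rfl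

@[simp] theorem truth_or : Truth F V x (.or φ ψ) ↔ Truth F V x φ ∨ Truth F V x ψ := Iff.rfl

@[simp] theorem truth_dia : Truth F V x (.dia φ) ↔ ∃ y, F.R x y ∧ Truth F V y φ := Iff.rfl

@[simp] theorem truth_bot : ¬ Truth F V x bot := fun h => h trivial

@[simp] theorem truth_and : Truth F V x (Form.and φ ψ) ↔ Truth F V x φ ∧ Truth F V x ψ := by
  simp [Form.and]

@[simp] theorem truth_imp : Truth F V x (imp φ ψ) ↔ (Truth F V x φ → Truth F V x ψ) := by
  simp [imp, imp_iff_not_or]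

@[simp] theorem truth_iff : Truth F V x (Form.iff φ ψ) ↔ (Truth F V x φ ↔ Truth F V x ψ) := by
  simp [Form.iff, iff_iff_implies_and_implies]

@[simp] theorem truth_box : Truth F V x (box φ) ↔ ∀ y, F.R x y → Truth F V y φ := by
  simp [box]

@[simp] theorem truth_disj_nil : ¬ Truth F V x (disj []) := truth_bot

@[simp] theorem truth_disj_cons {l : List Form} :
    Truth F V x (disj (φ :: l)) ↔ Truth F V x φ ∨ Truth F V x (disj l) := Iff.rfl

@[simp] theorem truth_conj_nil : Truth F V x (conj []) := trivial

@[simp] theorem truth_conj_cons {l : List Form} :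
    Truth F V x (conj (φ :: l)) ↔ Truth F V x φ ∧ Truth F V x (conj l) := truth_and

theorem truth_subst (σ : ℕ → Form) :
    Truth F V x (φ.subst σ) ↔ Truth F (fun i => {y | Truth F V y (σ i)}) x φ := by
  induction φ generalizing x with
  | atom i => rfl
  | top => rfl
  | neg φ ih => simp [Form.subst, ih]
  | or φ ψ ih₁ ih₂ => simp [Form.subst, ih₁, ih₂]
  | dia φ ih => simp [Form.subst, ih]

end Truth

/-- The frame with the reflexive closure of the accessibility relation. -/
def Frame.reflClosure (F : Frame.{u}) : Frame.{u} := ⟨F.W, fun x y => x = y ∨ F.R x y⟩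

/-- The translation `φ ↦ φ°` expresses truth in the reflexive closure. -/
theorem truth_circ {F : Frame.{u}} {V : ℕ → Set F.W} {x : F.W} {φ : Form} :
    Truth F V x φ.circ ↔ Truth F.reflClosure V x φ := by
  induction φ generalizing x with
  | atom i => rfl
  | top => rfl
  | neg φ ih => exact not_congr ih
  | or φ ψ ih₁ ih₂ => exact or_congr ih₁ ih₂
  | dia φ ih =>
    constructor
    · rintro (h | ⟨y, hy, h⟩)
      · exact ⟨x, .inl rfl, ih.1 h⟩
      · exact ⟨y, .inr hy, ih.1 h⟩
    · rintro ⟨y, rfl | hy, h⟩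
      · exact .inl (ih.2 h)
      · exact .inr ⟨y, hy, ih.2 h⟩

theorem Frame.validates_circ {F : Frame.{u}} {φ : Form} :
    F.Validates φ.circ ↔ F.reflClosure.Validates φ :=
  forall_congr' fun _ => forall_congr' fun _ => truth_circ

theorem Frame.validates_ax4 {F : Frame.{u}} :
    F.Validates ax4 ↔ ∀ x y z, F.R x y → F.R y z → F.R x z := by
  constructor
  · intro h x y z hxy hyz
    have := h (fun _ => {z}) x
    simp only [ax4, truth_imp, truth_dia, truth_atom, Set.mem_singleton_iff] at this
    obtain ⟨_, hz, rfl⟩ := this ⟨y, hxy, z, hyz, rfl⟩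
    exact hz
  · intro h V x
    simp only [ax4, truth_imp, truth_dia]
    rintro ⟨y, hxy, z, hyz, hz⟩
    exact ⟨z, h x y z hxy hyz, hz⟩

theorem Frame.validates_axT {F : Frame.{u}} : F.Validates axT ↔ ∀ x, F.R x x := by
  constructor
  · intro h x
    have := h (fun _ => {x}) x
    simp only [axT, truth_imp, truth_dia, truth_atom, Set.mem_singleton_iff] at this
    obtain ⟨_, hz, rfl⟩ := this trivial
    exact hz
  · intro h V x
    simp only [axT, truth_imp, truth_dia]
    exact fun hx => ⟨x, h x, hx⟩

/-! ### Smallest normal logics and general frames -/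

theorem subset_normalClosure (Γ : Set Form) : Γ ⊆ normalClosure Γ :=
  fun _ hφ _ _ hΓ => hΓ hφ

theorem isNormalLogic_normalClosure (Γ : Set Form) : IsNormalLogic (normalClosure Γ) where
  taut φ hφ _ hL _ := hL.taut φ hφ
  axiomK _ hL _ := hL.axiomK
  axiomDual _ hL _ := hL.axiomDual
  mp φ ψ h₁ h₂ L hL hΓ := hL.mp φ ψ (h₁ L hL hΓ) (h₂ L hL hΓ)
  gen φ h L hL hΓ := hL.gen φ (h L hL hΓ)
  subst φ σ h L hL hΓ := hL.subst φ σ (h L hL hΓ)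

theorem normalClosure_mono {Γ Δ : Set Form} (h : Γ ⊆ Δ) : normalClosure Γ ⊆ normalClosure Δ :=
  fun _ hφ L hL hΔ => hφ L hL (h.trans hΔ)

/-- The families of admissible sets of general frames on `F`. -/
structure IsAdmissible (F : Frame.{u}) (A : Set F.W → Prop) : Prop where
  univ : A Set.univ
  compl : ∀ X, A X → A Xᶜ
  union : ∀ X Y, A X → A Y → A (X ∪ Y)
  dia : ∀ X, A X → A {x | ∃ y, F.R x y ∧ y ∈ X}

theorem IsAdmissible.truth {F : Frame.{u}} {A : Set F.W → Prop} (hA : IsAdmissible F A)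
    {V : ℕ → Set F.W} (hV : ∀ i, A (V i)) (φ : Form) : A {x | Truth F V x φ} := by
  induction φ with
  | atom i => exact hV i
  | top => exact hA.univ
  | neg φ ih => exact hA.compl _ ih
  | or φ ψ ih₁ ih₂ => exact hA.union _ _ ih₁ ih₂
  | dia φ ih => exact hA.dia _ ih

/-- The logic of a general frame is normal. -/
theorem IsAdmissible.isNormalLogic {F : Frame.{u}} {A : Set F.W → Prop} (hA : IsAdmissible F A) :
    IsNormalLogic {φ | ∀ V : ℕ → Set F.W, (∀ i, A (V i)) → ∀ x, Truth F V x φ} where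
  taut φ hφ V _ x := hφ (Truth F V x) trivial (fun _ => Iff.rfl) (fun _ _ => Iff.rfl)
  axiomK V _ x := by
    simp only [truth_imp, truth_box]
    exact fun h₁ h₂ y hy => h₁ y hy (h₂ y hy)
  axiomDual V _ x := by simp
  mp φ ψ h₁ h₂ V hV x := truth_imp.1 (h₁ V hV x) (h₂ V hV x)
  gen φ h V hV x := truth_box.2 fun y _ => h V hV y
  subst φ σ h V hV x := (truth_subst σ).2 (h _ (fun i => hA.truth hV (σ i)) x)

/-! ### Frames validating `G` and `H` -/

section Formulas

variable {F : Frame.{u}} {V : ℕ → Set F.W} {x : F.W}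

theorem truth_fineB_zero : Truth F V x (fineB 0) ↔ x ∈ V 2 := Iff.rfl

theorem truth_fineB_one : Truth F V x (fineB 1) ↔ x ∈ V 3 := Iff.rfl

theorem truth_fineC_zero : Truth F V x (fineC 0) ↔ x ∈ V 4 := Iff.rfl

theorem truth_fineC_one : Truth F V x (fineC 1) ↔ x ∈ V 5 := Iff.rfl

theorem truth_fineB_add_two (m : ℕ) : Truth F V x (fineB (m + 2)) ↔
    (∃ y, F.R x y ∧ Truth F V y (fineB (m + 1))) ∧ (∃ y, F.R x y ∧ Truth F V y (fineC m)) ∧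
      ¬ ∃ y, F.R x y ∧ Truth F V y (fineC (m + 1)) := by
  change Truth F V x (conj [_, _, _]) ↔ _
  simp [fineB, fineC]

theorem truth_fineC_add_two (m : ℕ) : Truth F V x (fineC (m + 2)) ↔
    (∃ y, F.R x y ∧ Truth F V y (fineC (m + 1))) ∧ (∃ y, F.R x y ∧ Truth F V y (fineB m)) ∧
      ¬ ∃ y, F.R x y ∧ Truth F V y (fineB (m + 1)) := by
  change Truth F V x (conj [_, _, _]) ↔ _
  simp [fineB, fineC]

theorem truth_fineA (m : ℕ) : Truth F V x (fineA m) ↔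
    (¬ ∃ y, F.R x y ∧ y ∈ V 0) ∧ (∃ y, F.R x y ∧ Truth F V y (fineB (m + 1))) ∧
      (∃ y, F.R x y ∧ Truth F V y (fineC (m + 1))) ∧
      (¬ ∃ y, F.R x y ∧ Truth F V y (fineB (m + 2))) ∧
      ¬ ∃ y, F.R x y ∧ Truth F V y (fineC (m + 2)) := by
  simp [fineA, p0]

theorem truth_fineE : Truth F V x fineE ↔
    (∃ y, F.R x y ∧ y ∈ V 0) ∧
    (∀ y, F.R x y → y ∈ V 0 → ∃ z, F.R y z ∧ z ∈ V 1) ∧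
    (∀ y, F.R x y → y ∈ V 1 → ∃ z, F.R y z ∧ z ∈ V 0) ∧
    (∀ y, F.R x y → ¬ (y ∈ V 0 ∧ y ∈ V 1)) ∧
    (∀ y, F.R x y → y ∈ V 3 → (∃ z, F.R y z ∧ z ∈ V 2) ∧ ¬ ∃ z, F.R y z ∧ z ∈ V 4) ∧
    (∀ y, F.R x y → y ∈ V 5 → (∃ z, F.R y z ∧ z ∈ V 4) ∧ ¬ ∃ z, F.R y z ∧ z ∈ V 2) ∧
    (∀ y, F.R x y → y ∈ V 2 → ¬ ∃ z, F.R y z ∧ z ∈ V 3) ∧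
    (∀ y, F.R x y → y ∈ V 4 → ¬ ∃ z, F.R y z ∧ z ∈ V 5) ∧
    ∃ y, F.R x y ∧ Truth F V y (fineA 0) := by
  simp only [fineE, p0, p1, q0, q1, r0, r1, truth_conj_cons, truth_conj_nil, truth_dia, truth_box,
    truth_imp, truth_neg, truth_and, truth_atom, and_true]

theorem truth_fineG : Truth F V x fineG ↔ (Truth F V x fineE →
    ∃ y, F.R x y ∧ (∃ z, F.R y z ∧ z ∈ V 0) ∧ (¬ ∃ z, F.R y z ∧ Truth F V z (fineA 0)) ∧
      ∃ z, F.R y z ∧ Truth F V z (fineA 1)) := by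
  simp only [fineG, p0, truth_conj_cons, truth_conj_nil, truth_dia,
    truth_imp, truth_neg, truth_atom, and_true]

theorem truth_fineH : Truth F V x fineH ↔ ¬ (x ∈ V 6 ∧ ∀ y, F.R x y → y ∈ V 6 →
    ∃ y₁, F.R y y₁ ∧ y₁ ∉ V 6 ∧ y₁ ∈ V 7 ∧
      ∃ y₂, F.R y₁ y₂ ∧ y₂ ∉ V 6 ∧ y₂ ∉ V 7 ∧ ∃ y₃, F.R y₂ y₃ ∧ y₃ ∈ V 6) := by
  simp only [fineH, s, t, truth_conj_cons, truth_conj_nil, truth_dia, truth_box, truth_and,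
    truth_imp, truth_neg, truth_atom, and_true]

/-- The valuation giving `q₀, q₁, r₀, r₁` the values of `B 1, B 2, C 1, C 2`. -/
def shift (F : Frame.{u}) (V : ℕ → Set F.W) : ℕ → Set F.W
  | 2 => {y | Truth F V y (fineB 1)}
  | 3 => {y | Truth F V y (fineB 2)}
  | 4 => {y | Truth F V y (fineC 1)}
  | 5 => {y | Truth F V y (fineC 2)}
  | i => V i

/-- The recursion is the same for every index, so moving the initial values one place moves the
whole sequence; B and C are entangled and go together. -/
theorem truth_shift_fineBC (m : ℕ) : ∀ x,
    (Truth F (shift F V) x (fineB m) ↔ Truth F V x (fineB (m + 1))) ∧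
    (Truth F (shift F V) x (fineC m) ↔ Truth F V x (fineC (m + 1))) := by
  induction m using Nat.strong_induction_on with
  | _ m ih =>
    match m with
    | 0 => exact fun _ => ⟨Iff.rfl, Iff.rfl⟩
    | 1 => exact fun _ => ⟨Iff.rfl, Iff.rfl⟩
    | m + 2 =>
      have h₀ := ih m (by omega)
      have h₁ := ih (m + 1) (by omega)
      intro x
      simp [truth_fineB_add_two, truth_fineC_add_two, h₀, h₁]

theorem truth_shift_fineA (m : ℕ) :
    Truth F (shift F V) x (fineA m) ↔ Truth F V x (fineA (m + 1)) := by
  simp only [truth_fineA, truth_shift_fineBC]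
  rfl

/-- If `G` is valid, a point of `E` sees one at which the shifted `E` is true and `A 0` is not
seen. -/
theorem exists_truth_fineE_shift (ht : ∀ x y z, F.R x y → F.R y z → F.R x z)
    (hG : F.Validates fineG) (hx : Truth F V x fineE) :
    ∃ y, F.R x y ∧ (¬ ∃ z, F.R y z ∧ Truth F V z (fineA 0)) ∧ Truth F (shift F V) y fineE := by
  obtain ⟨y, hxy, hp, hA, z, hyz, hz⟩ := truth_fineG.1 (hG V x) hx
  obtain ⟨-, h01, h10, hd, hq, hr, -, -, -⟩ := truth_fineE.1 hx
  refine ⟨y, hxy, hA, truth_fineE.2 ⟨hp, fun u hu => h01 u (ht _ _ _ hxy hu),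
    fun u hu => h10 u (ht _ _ _ hxy hu), fun u hu => hd u (ht _ _ _ hxy hu), ?_, ?_, ?_, ?_,
    z, hyz, (truth_shift_fineA 0).2 hz⟩⟩
  · intro u _ hB
    obtain ⟨h₁, -, h₂⟩ := (truth_fineB_add_two 0).1 hB
    exact ⟨h₁, h₂⟩
  · intro u _ hC
    obtain ⟨h₁, -, h₂⟩ := (truth_fineC_add_two 0).1 hC
    exact ⟨h₁, h₂⟩
  -- B 2 at `v` includes ◇C 0, so the q₁-point `u` would see r₀, against E.
  · rintro u hu hB ⟨v, huv, hB'⟩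
    obtain ⟨-, ⟨w, hvw, hw⟩, -⟩ := (truth_fineB_add_two 0).1 hB'
    exact (hq u (ht _ _ _ hxy hu) hB).2 ⟨w, ht _ _ _ huv hvw, hw⟩
  · rintro u hu hC ⟨v, huv, hC'⟩
    obtain ⟨-, ⟨w, hvw, hw⟩, -⟩ := (truth_fineC_add_two 0).1 hC'
    exact (hr u (ht _ _ _ hxy hu) hC).2 ⟨w, ht _ _ _ huv hvw, hw⟩

/-- An infinite path without repetitions refutes `H`. -/
theorem not_validates_fineH_of_injective (f : ℕ → F.W) (hf : Function.Injective f)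
    (hR : ∀ n, F.R (f n) (f (n + 1))) : ¬ F.Validates fineH := by
  intro hH
  -- s holds at the indices divisible by 3 and t at those congruent to 1; the path thus runs through
  -- s, ¬s ∧ t, ¬s ∧ ¬t cyclically.
  refine truth_fineH.1 (hH (fun i => if i = 6 then {y | ∃ k, f (3 * k) = y}
    else {y | ∃ k, f (3 * k + 1) = y}) (f 0)) ⟨⟨0, rfl⟩, ?_⟩
  rintro _ - ⟨k, rfl⟩
  refine ⟨f (3 * k + 1), hR _, ?_, ⟨k, rfl⟩, f (3 * k + 2), hR _, ?_, ?_,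
    f (3 * k + 3), hR _, ⟨k + 1, rfl⟩⟩
  all_goals
    rintro ⟨j, hj⟩
    have := hf hj
    omega

/-- Reflexive transitive frames validating `G` and `H` refute `E`. -/
theorem validates_neg_fineE (hr : ∀ x, F.R x x) (ht : ∀ x y z, F.R x y → F.R y z → F.R x z)
    (hG : F.Validates fineG) (hH : F.Validates fineH) : F.Validates (neg fineE) := by
  intro V x hx
  -- The valuation changes at each step, so it is carried along with the point.
  let S := {p : (ℕ → Set F.W) × F.W // Truth F p.1 p.2 fineE}
  have step : ∀ p : S, ∃ p' : S, F.R p.1.2 p'.1.2 ∧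
      ¬ ∃ z, F.R p'.1.2 z ∧ Truth F p.1.1 z (fineA 0) := by
    rintro ⟨⟨V, x⟩, h⟩
    obtain ⟨y, hxy, hA, hE⟩ := exists_truth_fineE_shift ht hG h
    exact ⟨⟨⟨shift F V, y⟩, hE⟩, hxy, hA⟩
  choose next hnext hA using step
  let g : ℕ → S := fun n => next^[n] ⟨⟨V, x⟩, hx⟩
  have hg : ∀ n, g (n + 1) = next (g n) := fun n => Function.iterate_succ_apply' _ _ _
  have hR : ∀ n, F.R (g n).1.2 (g (n + 1)).1.2 := fun n => hg n ▸ hnext _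
  have hmono : ∀ i k, F.R (g i).1.2 (g (i + k)).1.2 := by
    intro i k
    induction k with
    | zero => exact hr _
    | succ k ih => exact ht _ _ _ ih (hR _)
  have hne : ∀ i j, i < j → (g i).1.2 ≠ (g j).1.2 := by
    intro i j hij he
    obtain ⟨k, rfl⟩ := Nat.exists_eq_add_of_lt hij
    obtain ⟨-, -, -, -, -, -, -, -, z, hz, hzA⟩ := truth_fineE.1 (g i).2
    -- Point `i` sees its own A 0, while point `i + 1`, hence everything it sees, misses it; a
    -- repetition would contradict this.
    apply hA (g i)
    rw [← hg]
    refine ⟨z, ht _ _ _ (hmono (i + 1) k) ?_, hzA⟩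
    rw [show i + 1 + k = i + k + 1 by omega, ← he]
    exact hz
  refine not_validates_fineH_of_injective (fun n => (g n).1.2) ?_ hR hH
  intro i j hij
  rcases lt_trichotomy i j with h | h | h
  · exact absurd hij (hne i j h)
  · exact h
  · exact absurd hij.symm (hne j i h)

end Formulas

/-! ### The countermodel -/

/-- The points of the countermodel: two descending sequences `side true n` and `side false n`,
points `join n` above their initial segments, an ascending chain `spine n`, and a two-element
cluster `loop i`. -/
inductive Point : Type where
  | side (σ : Bool) (n : ℕ)
  | join (n : ℕ)
  | spine (n : ℕ)
  | loop (i : Bool)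

namespace Point

/-- The accessibility relation of the countermodel, irreflexive outside the cluster. -/
def Rel : Point → Point → Prop
  | side σ n, side τ k => k + (if σ = τ then 1 else 2) ≤ n
  | join n, side _ k => k ≤ n + 1
  | spine _, side _ _ => True
  | spine n, join k => n ≤ k
  | spine n, spine k => n < k
  | spine _, loop _ => True
  | loop _, side _ _ => True
  | loop _, loop _ => True
  | _, _ => False

/-- The reflexive closure of `Rel`. -/
def Le (x y : Point) : Prop := x = y ∨ Rel x y

theorem rel_trans (x y z : Point) (hxy : Rel x y) (hyz : Rel y z) : Rel x z := by
  rcases x with ⟨σ, n⟩ | n | n | i <;> rcases y with ⟨τ, m⟩ | m | m | j <;>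
    rcases z with ⟨ρ, k⟩ | k | k | l <;> simp only [Rel] at * <;> try omega
  cases σ <;> cases τ <;> cases ρ <;> simp at * <;> omega

theorem Le.refl (x : Point) : Le x x := .inl rfl

theorem Le.trans {x y z : Point} (hxy : Le x y) (hyz : Le y z) : Le x z := by
  rcases hxy with rfl | hxy
  · exact hyz
  · rcases hyz with rfl | hyz
    · exact .inr hxy
    · exact .inr (rel_trans _ _ _ hxy hyz)

/-! ### The reflexive order on points -/

section Le

variable {σ τ i j : Bool} {n k : ℕ}

@[simp] theorem side_le_side :
    Le (side σ n) (side τ k) ↔ k + (if σ = τ then 0 else 2) ≤ n := by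
  by_cases h : σ = τ <;> simp [Le, Rel, h]
  omega

@[simp] theorem side_le_join : ¬ Le (side σ n) (join k) := by simp [Le, Rel]

@[simp] theorem side_le_spine : ¬ Le (side σ n) (spine k) := by simp [Le, Rel]

@[simp] theorem side_le_loop : ¬ Le (side σ n) (loop i) := by simp [Le, Rel]

@[simp] theorem join_le_side : Le (join n) (side σ k) ↔ k ≤ n + 1 := by simp [Le, Rel]

@[simp] theorem join_le_join : Le (join n) (join k) ↔ n = k := by simp [Le, Rel]

@[simp] theorem join_le_spine : ¬ Le (join n) (spine k) := by simp [Le, Rel]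

@[simp] theorem join_le_loop : ¬ Le (join n) (loop i) := by simp [Le, Rel]

@[simp] theorem spine_le_side : Le (spine n) (side σ k) := by simp [Le, Rel]

@[simp] theorem spine_le_join : Le (spine n) (join k) ↔ n ≤ k := by simp [Le, Rel]

@[simp] theorem spine_le_spine : Le (spine n) (spine k) ↔ n ≤ k := by
  simp [Le, Rel, le_iff_eq_or_lt]

@[simp] theorem spine_le_loop : Le (spine n) (loop i) := by simp [Le, Rel]

@[simp] theorem loop_le_side : Le (loop i) (side σ k) := by simp [Le, Rel]

@[simp] theorem loop_le_join : ¬ Le (loop i) (join k) := by simp [Le, Rel]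

@[simp] theorem loop_le_spine : ¬ Le (loop i) (spine k) := by simp [Le, Rel]

@[simp] theorem loop_le_loop : Le (loop i) (loop j) := by simp [Le, Rel]

end Le

/-- Two points with incomparable sets of successors are `side` points of the same index. -/
theorem eq_side_of_not_subset {x y : Point} (hxy : ∃ z, Rel x z ∧ ¬ Rel y z)
    (hyx : ∃ z, Rel y z ∧ ¬ Rel x z) : ∃ σ n, x = side σ n ∧ y = side (!σ) n := by
  obtain ⟨z, hz, hz'⟩ := hxy
  obtain ⟨v, hv, hv'⟩ := hyx
  rcases x with ⟨σ, n⟩ | n | n | i <;> rcases y with ⟨τ, m⟩ | m | m | j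
  case side.side =>
    refine ⟨σ, n, rfl, ?_⟩
    rcases z with ⟨ρ, k⟩ | k | k | k <;> rcases v with ⟨ρ', k'⟩ | k' | k' | k' <;>
      simp only [Rel] at hz hz' hv hv'
    cases σ <;> cases τ <;> cases ρ <;> cases ρ' <;> simp at * <;> omega
  all_goals
    exfalso
    rcases z with ⟨ρ, k⟩ | k | k | k <;> rcases v with ⟨ρ', k'⟩ | k' | k' | k' <;>
      simp only [Rel, not_true] at hz hz' hv hv' <;> first | omega | (split_ifs at * <;> omega)

/-- The set contains all or none of the points of `spine` from some index on. -/
def EventuallyConst (X : Set Point) : Prop :=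
  ∃ N, ∀ n, N ≤ n → (spine n ∈ X ↔ spine N ∈ X)

/-- Earlier chain points see at least what later ones see, so truth of ◇X, once lost along the
chain, stays lost. Stated for a general relation to cover both `Rel` and `Le`. -/
theorem isAdmissible_eventuallyConst (S : Point → Point → Prop)
    (hS : ∀ m n y, m ≤ n → S (spine n) y → S (spine m) y) :
    IsAdmissible ⟨Point, S⟩ EventuallyConst where
  univ := ⟨0, fun _ _ => Iff.rfl⟩
  compl := fun X ⟨N, hN⟩ => ⟨N, fun n hn => not_congr (hN n hn)⟩
  union := by
    rintro X Y ⟨N, hN⟩ ⟨M, hM⟩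
    refine ⟨max N M, fun n hn => or_congr ?_ ?_⟩
    · rw [hN n (by omega), hN (max N M) (by omega)]
    · rw [hM n (by omega), hM (max N M) (by omega)]
  dia := by
    intro X _
    by_cases h : ∃ N, ¬ ∃ y, S (spine N) y ∧ y ∈ X
    · obtain ⟨N, hN⟩ := h
      refine ⟨N, fun n hn => iff_of_false ?_ hN⟩
      rintro ⟨y, hy, hX⟩
      exact hN ⟨y, hS _ _ _ hn hy, hX⟩
    · push Not at h
      exact ⟨0, fun n _ => iff_of_true (h n) (h 0)⟩

/-- An eventually constant set and its complement are not both cofinal in the chain. -/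
theorem EventuallyConst.false_of_cofinal {X : Set Point} (hX : EventuallyConst X)
    (h₁ : ∀ N, ∃ n, N ≤ n ∧ spine n ∈ X) (h₂ : ∀ N, ∃ n, N ≤ n ∧ spine n ∉ X) : False := by
  obtain ⟨N, hN⟩ := hX
  obtain ⟨n, hn, hnX⟩ := h₁ N
  obtain ⟨m, hm, hmX⟩ := h₂ N
  exact hmX ((hN m hm).2 ((hN n hn).1 hnX))

/-- The points outside the chain and the cluster. -/
def IsLow : Point → Prop
  | side _ _ => True
  | join _ => True
  | _ => False

/-- A rank which decreases strictly along `Rel` on the points outside the chain and the cluster. -/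
def rank : Point → ℕ
  | side _ n => n
  -- `join n` sees `side` points up to index `n + 1`.
  | join n => n + 2
  | _ => 0

theorem IsLow.of_le {x y : Point} (hx : IsLow x) (hxy : Le x y) : IsLow y := by
  rcases x with ⟨σ, n⟩ | n | n | i <;> rcases y with ⟨τ, m⟩ | m | m | j <;> simp_all [IsLow]

theorem IsLow.rank_lt {x y : Point} (hx : IsLow x) (hxy : Le x y) (hne : x ≠ y) :
    rank y < rank x := by
  have h : Rel x y := hxy.resolve_left hne
  rcases x with ⟨σ, n⟩ | n | n | i <;> rcases y with ⟨τ, m⟩ | m | m | j <;>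
    simp only [IsLow, Rel, rank] at * <;> first | omega | (split_ifs at h <;> omega)

/-- A set of `IsLow` points in which every point strictly sees another one is empty. -/
theorem not_mem_of_isLow {X : Point → Prop}
    (hX : ∀ y, X y → IsLow y → ∃ z, X z ∧ Le y z ∧ y ≠ z) (y : Point) (hy : IsLow y) : ¬ X y := by
  induction h : rank y using Nat.strong_induction_on generalizing y with
  | _ r ih =>
    intro hXy
    obtain ⟨z, hz, hyz, hne⟩ := hX y hXy hy
    exact ih _ (h ▸ hy.rank_lt hyz hne) z (hy.of_le hyz) rfl hz

theorem not_isLow_of_le {x y : Point} (hxy : Le x y) (hy : ¬ IsLow y) : ¬ IsLow x :=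
  fun hx => hy (hx.of_le hxy)

/-- No eventually constant set `X` refutes `H`. -/
theorem not_cycle {X Y : Set Point} (hXc : EventuallyConst X) {x : Point} (hx : x ∈ X)
    (h : ∀ y, Le x y → y ∈ X → ∃ y₁, Le y y₁ ∧ y₁ ∉ X ∧ y₁ ∈ Y ∧
      ∃ y₂, Le y₁ y₂ ∧ y₂ ∉ X ∧ y₂ ∉ Y ∧ ∃ y₃, Le y₂ y₃ ∧ y₃ ∈ X) : False := by
  have hlow : ∀ y, IsLow y → ¬ (Le x y ∧ y ∈ X) := by
    refine not_mem_of_isLow ?_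
    rintro y ⟨hxy, hy⟩ hl
    obtain ⟨y₁, h₁, hX₁, -, y₂, h₂, -, -, y₃, h₃, hX₃⟩ := h y hxy hy
    have hy₃ := (h₁.trans h₂).trans h₃
    refine ⟨y₃, ⟨hxy.trans hy₃, hX₃⟩, hy₃, ?_⟩
    -- Returning to `y` through `y₁ ≠ y` would lower the rank twice around a circle.
    rintro rfl
    have hne : y ≠ y₁ := fun e => hX₁ (e ▸ hy)
    have a := hl.rank_lt h₁ hne
    have b := (hl.of_le h₁).rank_lt (h₂.trans h₃) hne.symm
    omega
  have hloop : ∀ i, ¬ (Le x (loop i) ∧ loop i ∈ X) := by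
    rintro i ⟨hxi, hi⟩
    obtain ⟨y₁, h₁, hX₁, hY₁, y₂, h₂, hX₂, hY₂, y₃, h₃, hX₃⟩ := h _ hxi hi
    have hl₃ : ¬ IsLow y₃ := fun hl => hlow _ hl ⟨hxi.trans ((h₁.trans h₂).trans h₃), hX₃⟩
    have hl₂ := not_isLow_of_le h₃ hl₃
    have hl₁ := not_isLow_of_le h₂ hl₂
    rcases y₁ with _ | _ | _ | j <;> simp [IsLow] at hl₁ h₁
    rcases y₂ with _ | _ | _ | k <;> simp [IsLow] at hl₂ h₂
    -- Three mutually exclusive conditions do not fit in a cluster of two points.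
    cases i <;> cases j <;> cases k <;> contradiction
  have hspine : ∀ y, Le x y → y ∈ X → ∃ n, y = spine n := by
    intro y hxy hy
    rcases y with ⟨σ, n⟩ | n | n | i
    · exact (hlow (side _ _) trivial ⟨hxy, hy⟩).elim
    · exact (hlow (join _) trivial ⟨hxy, hy⟩).elim
    · exact ⟨n, rfl⟩
    · exact (hloop _ ⟨hxy, hy⟩).elim
  obtain ⟨n, rfl⟩ := hspine x (.refl _) hx
  have step : ∀ m, n ≤ m → spine m ∈ X →
      ∃ k l, m < k ∧ spine k ∉ X ∧ k ≤ l ∧ spine l ∈ X := by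
    intro m hnm hm
    obtain ⟨y₁, h₁, hX₁, -, y₂, h₂, -, -, y₃, h₃, hX₃⟩ := h (spine m) (by simpa) hm
    obtain ⟨l, rfl⟩ := hspine y₃ ((((spine_le_spine.2 hnm).trans h₁).trans h₂).trans h₃) hX₃
    have h₁₃ := h₂.trans h₃
    rcases y₁ with _ | _ | k | _ <;> simp at h₁₃ h₁
    exact ⟨k, l, lt_of_le_of_ne h₁ (fun e => hX₁ (e ▸ hm)), hX₁, h₁₃, hX₃⟩
  have hcof : ∀ N, ∃ m, N ≤ m ∧ n ≤ m ∧ spine m ∈ X := by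
    intro N
    induction N with
    | zero => exact ⟨n, by omega, le_rfl, hx⟩
    | succ N ih =>
      obtain ⟨m, hm, hnm, hmX⟩ := ih
      obtain ⟨k, l, hmk, -, hkl, hl⟩ := step m hnm hmX
      exact ⟨l, by omega, by omega, hl⟩
  refine hXc.false_of_cofinal (fun N => ?_) (fun N => ?_)
  · obtain ⟨m, hm, -, hmX⟩ := hcof N
    exact ⟨m, hm, hmX⟩
  · obtain ⟨m, hm, hnm, hmX⟩ := hcof N
    obtain ⟨k, l, hmk, hk, -, -⟩ := step m hnm hmX
    exact ⟨k, by omega, hk⟩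

/-- Disjoint eventually constant sets which alternate above `x` meet above `x` only in the chain
and the cluster, and the first, if it is met, contains a point of the cluster. -/
theorem alternating {X Y : Set Point} (hX : EventuallyConst X) {x : Point}
    (hXY : ∀ y, Le x y → y ∈ X → ∃ z, Le y z ∧ z ∈ Y)
    (hYX : ∀ y, Le x y → y ∈ Y → ∃ z, Le y z ∧ z ∈ X)
    (hd : ∀ y, Le x y → ¬ (y ∈ X ∧ y ∈ Y)) :
    (∀ y, IsLow y → Le x y → y ∉ X) ∧
      ((∃ y, Le x y ∧ y ∈ X) → ∃ i, Le x (loop i) ∧ loop i ∈ X) := by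
  have hlow : ∀ y, IsLow y → ¬ (Le x y ∧ (y ∈ X ∨ y ∈ Y)) := by
    refine not_mem_of_isLow ?_
    rintro y ⟨hxy, hy | hy⟩ -
    · obtain ⟨z, hz, hzY⟩ := hXY y hxy hy
      exact ⟨z, ⟨hxy.trans hz, .inr hzY⟩, hz, fun e => hd y hxy ⟨hy, e ▸ hzY⟩⟩
    · obtain ⟨z, hz, hzX⟩ := hYX y hxy hy
      exact ⟨z, ⟨hxy.trans hz, .inl hzX⟩, hz, fun e => hd y hxy ⟨e ▸ hzX, hy⟩⟩
  refine ⟨fun y hl hxy hy => hlow y hl ⟨hxy, .inl hy⟩, ?_⟩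
  rintro ⟨y, hxy, hy⟩
  by_contra hno
  push Not at hno
  have hYspine : ∀ z, Le x z → z ∈ Y → ∃ n, z = spine n := by
    intro z hxz hz
    rcases z with ⟨σ, n⟩ | n | n | i
    · exact (hlow (side _ _) trivial ⟨hxz, .inr hz⟩).elim
    · exact (hlow (join _) trivial ⟨hxz, .inr hz⟩).elim
    · exact ⟨n, rfl⟩
    -- A cluster point sees only the cluster and low points, and neither contains a point of `X`
    -- above `x`.
    · obtain ⟨v, hv, hvX⟩ := hYX _ hxz hz
      rcases v with ⟨σ, n⟩ | n | n | j <;> simp at hv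
      · exact (hlow (side _ _) trivial ⟨hxz.trans (by simp), .inl hvX⟩).elim
      · exact (hno j (hxz.trans (by simp)) hvX).elim
  have hXspine : ∀ z, Le x z → z ∈ X → ∃ n, z = spine n := by
    intro z hxz hz
    rcases z with ⟨σ, n⟩ | n | n | i
    · exact (hlow (side _ _) trivial ⟨hxz, .inl hz⟩).elim
    · exact (hlow (join _) trivial ⟨hxz, .inl hz⟩).elim
    · exact ⟨n, rfl⟩
    · exact (hno i hxz hz).elim
  have step : ∀ m, Le x (spine m) → spine m ∈ X →
      ∃ k l, m < k ∧ spine k ∉ X ∧ k ≤ l ∧ spine l ∈ X ∧ Le x (spine l) := by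
    intro m hxm hm
    obtain ⟨z, hz, hzY⟩ := hXY _ hxm hm
    obtain ⟨k, rfl⟩ := hYspine z (hxm.trans hz) hzY
    have hxk := hxm.trans hz
    have hkX : spine k ∉ X := fun e => hd _ hxk ⟨e, hzY⟩
    obtain ⟨v, hv, hvX⟩ := hYX _ hxk hzY
    obtain ⟨l, rfl⟩ := hXspine v (hxk.trans hv) hvX
    exact ⟨k, l, lt_of_le_of_ne (spine_le_spine.1 hz) (fun e => hkX (e ▸ hm)), hkX,
      spine_le_spine.1 hv, hvX, hxk.trans hv⟩
  obtain ⟨n, rfl⟩ := hXspine y hxy hy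
  have hcof : ∀ N, ∃ m, N ≤ m ∧ Le x (spine m) ∧ spine m ∈ X := by
    intro N
    induction N with
    | zero => exact ⟨n, by omega, hxy, hy⟩
    | succ N ih =>
      obtain ⟨m, hm, hxm, hmX⟩ := ih
      obtain ⟨k, l, hmk, -, hkl, hl, hxl⟩ := step m hxm hmX
      exact ⟨l, by omega, hxl, hl⟩
  refine hX.false_of_cofinal (fun N => ?_) (fun N => ?_)
  · obtain ⟨m, hm, -, hmX⟩ := hcof N
    exact ⟨m, hm, hmX⟩
  · obtain ⟨m, hm, hxm, hmX⟩ := hcof N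
    obtain ⟨k, l, hmk, hk, -⟩ := step m hxm hmX
    exact ⟨k, by omega, hk⟩

end Point

namespace Point

/-! ### What the conditions of E force -/

section Analysis

variable {x : Point} {Q₀ Q₁ R₀ R₁ : Set Point} {σ : Bool} {n : ℕ}

/-- Under the conditions of `E`, the points of `q₁` and `r₁` seen from outside the chain and the
cluster are `side` points of the same index. -/
theorem exists_side_mem
    (hq₁ : ∀ y, Le x y → y ∈ Q₁ → (∃ z, Le y z ∧ z ∈ Q₀) ∧ ¬ ∃ z, Le y z ∧ z ∈ R₀)
    (hr₁ : ∀ y, Le x y → y ∈ R₁ → (∃ z, Le y z ∧ z ∈ R₀) ∧ ¬ ∃ z, Le y z ∧ z ∈ Q₀)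
    (hq₀ : ∀ y, Le x y → y ∈ Q₀ → ¬ ∃ z, Le y z ∧ z ∈ Q₁)
    (hr₀ : ∀ y, Le x y → y ∈ R₀ → ¬ ∃ z, Le y z ∧ z ∈ R₁)
    {a : Point} (hxa : Le x a) (ha : IsLow a) (haQ : ∃ z, Le a z ∧ z ∈ Q₁)
    (haR : ∃ z, Le a z ∧ z ∈ R₁) :
    ∃ σ n, side σ n ∈ Q₀ ∧ side (!σ) n ∈ R₀ ∧ side σ (n + 1) ∈ Q₁ ∧ side (!σ) (n + 1) ∈ R₁ := by
  obtain ⟨b, hab, hb⟩ := haQ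
  obtain ⟨c, hac, hc⟩ := haR
  obtain ⟨⟨b₀, hbb₀, hb₀⟩, hbR⟩ := hq₁ b (hxa.trans hab) hb
  obtain ⟨⟨c₀, hcc₀, hc₀⟩, hcQ⟩ := hr₁ c (hxa.trans hac) hc
  have hbc₀ : ¬ Le b c₀ := fun h => hbR ⟨_, h, hc₀⟩
  have hcb₀ : ¬ Le c b₀ := fun h => hcQ ⟨_, h, hb₀⟩
  have hb₀b : ¬ Le b₀ b := fun h => hq₀ b₀ ((hxa.trans hab).trans hbb₀) hb₀ ⟨_, h, hb⟩
  have hc₀c : ¬ Le c₀ c := fun h => hr₀ c₀ ((hxa.trans hac).trans hcc₀) hc₀ ⟨_, h, hc⟩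
  have hba : b ≠ a := fun h => hbc₀ (h ▸ hac.trans hcc₀)
  have hca : c ≠ a := fun h => hcb₀ (h ▸ hab.trans hbb₀)
  have key : ∀ {v : Point}, Le a v → v ≠ a → ∃ τ k, v = side τ k := by
    intro v hav hv
    rcases a with ⟨τ, m⟩ | m | m | j <;> rcases v with ⟨ρ, k⟩ | k | k | l <;>
      simp_all [IsLow]
  obtain ⟨τ, k, rfl⟩ := key hab hba
  obtain ⟨ρ, l, rfl⟩ := key hac hca
  rcases b₀ with ⟨τ', k'⟩ | k' | k' | k' <;> simp only [side_le_side, side_le_join, side_le_spine,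
    side_le_loop] at hbb₀
  rcases c₀ with ⟨ρ', l'⟩ | l' | l' | l' <;> simp only [side_le_side, side_le_join, side_le_spine,
    side_le_loop] at hcc₀
  simp only [side_le_side] at hbc₀ hcb₀ hb₀b hc₀c
  -- Points on one side are comparable, so `b` and `c` lie on opposite sides. Crossing costs two
  -- indices and staying costs one, which leaves only equal indices, with `b₀` and `c₀` directly
  -- below.
  have : τ' = τ ∧ ρ = (!τ) ∧ ρ' = (!τ) ∧ k = k' + 1 ∧ l = k' + 1 ∧ l' = k' := by
    cases τ <;> cases τ' <;> cases ρ <;> cases ρ' <;> simp at * <;> omega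
  obtain ⟨rfl, rfl, rfl, rfl, rfl, rfl⟩ := this
  exact ⟨_, _, hb₀, hc₀, hb, hc⟩

/-- Under the conditions of `E`, the atom `r₁` is true at only one point. -/
theorem eq_side_of_mem
    (hr₁ : ∀ y, Le x y → y ∈ R₁ → (∃ z, Le y z ∧ z ∈ R₀) ∧ ¬ ∃ z, Le y z ∧ z ∈ Q₀)
    (hr₀ : ∀ y, Le x y → y ∈ R₀ → ¬ ∃ z, Le y z ∧ z ∈ R₁)
    (hx : ∀ τ k, Le x (side τ k))
    (hq : ¬ ∃ z, Le (side σ (n + 1)) z ∧ z ∈ R₀)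
    (hQ₀ : side σ n ∈ Q₀) (hR₀ : side (!σ) n ∈ R₀)
    {y : Point} (hxy : Le x y) (hy : y ∈ R₁) : y = side (!σ) (n + 1) := by
  obtain ⟨⟨v, hyv, hv⟩, hyQ⟩ := hr₁ y hxy hy
  have h₁ : ¬ Le y (side σ n) := fun h => hyQ ⟨_, h, hQ₀⟩
  have h₂ : ¬ Le (side (!σ) n) y := fun h => hr₀ _ (hx _ _) hR₀ ⟨_, h, hy⟩
  have h₃ : ¬ Le (side σ (n + 1)) v := fun h => hq ⟨_, h, hv⟩
  have h₄ : ¬ Le v y := fun h => hr₀ v (hxy.trans hyv) hv ⟨_, h, hy⟩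
  -- `h₁` keeps `y` low, `h₃` keeps `v` high, and by `h₄` `v` is strictly below `y`; only one
  -- position remains.
  rcases y with ⟨τ, k⟩ | k | k | i <;> rcases v with ⟨ρ, l⟩ | l | l | j <;>
    simp only [side_le_side, side_le_join, side_le_spine, side_le_loop, join_le_side,
      join_le_join, join_le_spine, join_le_loop, spine_le_side, loop_le_side, not_true,
      reduceCtorEq, side.injEq] at *
  · cases σ <;> cases τ <;> cases ρ <;> simp at * <;> omega
  · cases σ <;> cases ρ <;> simp at * <;> omega
  · omega

/-- Once a formula singles out a point, its ◇ is the order itself; the recursion for B and C becomes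
arithmetic on indices. -/
theorem exists_le_and_iff {P : Point → Prop} {a : Point} (hP : ∀ z, Le x z → (P z ↔ z = a))
    (hxa : Le x a) {y : Point} (hxy : Le x y) : (∃ z, Le y z ∧ P z) ↔ Le y a := by
  constructor
  · rintro ⟨z, hyz, hz⟩
    exact (hP z (hxy.trans hyz)).1 hz ▸ hyz
  · exact fun h => ⟨a, h, (hP a hxa).2 rfl⟩

/-- The base case B 2: r₀ may hold at several points, so only what E says about it is available. -/
theorem eq_side_iff_of_not_le (hq : ¬ ∃ z, Le (side σ (n + 1)) z ∧ z ∈ R₀)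
    (hR₀ : side (!σ) n ∈ R₀) {y : Point} :
    (Le y (side σ (n + 1)) ∧ (∃ z, Le y z ∧ z ∈ R₀) ∧ ¬ Le y (side (!σ) (n + 1))) ↔
      y = side σ (n + 2) := by
  constructor
  · rintro ⟨h₁, h₂, h₃⟩
    have h₄ : y ≠ side σ (n + 1) := fun h => hq (h ▸ h₂)
    rcases y with ⟨τ, k⟩ | k | k | i <;> simp at h₁ h₃ h₄ ⊢
    · cases σ <;> cases τ <;> simp at * <;> omega
    · omega
  · rintro rfl
    refine ⟨by simp, ⟨_, ?_, hR₀⟩, by simp⟩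
    simp

theorem eq_side_iff {y : Point} :
    (Le y (side σ (n + 1)) ∧ Le y (side (!σ) n) ∧ ¬ Le y (side (!σ) (n + 1))) ↔
      y = side σ (n + 2) := by
  constructor
  · rintro ⟨h₁, h₂, h₃⟩
    rcases y with ⟨τ, k⟩ | k | k | i <;> simp at h₁ h₂ h₃ ⊢
    · cases σ <;> cases τ <;> simp at * <;> omega
    · omega
  · rintro rfl
    simp

/-- A `side` point seeing index `n + 1` on the opposite side has index at least `n + 3`, so it sees
`n + 2` on its own. -/
theorem eq_join {y : Point} (h₁ : Le y (side σ (n + 1))) (h₂ : Le y (side (!σ) (n + 1)))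
    (h₃ : ¬ Le y (side σ (n + 2))) (h₄ : ¬ Le y (side (!σ) (n + 2))) : y = join n := by
  rcases y with ⟨τ, k⟩ | k | k | i <;> simp at h₁ h₂ h₃ h₄ ⊢
  · cases σ <;> cases τ <;> simp at * <;> omega
  · omega

end Analysis

end Point

/-! ### The general frames validate the axioms and refute ¬E -/

open Point

/-- The frame of the countermodel. -/
abbrev pointFrame : Frame.{0} := ⟨Point, Rel⟩

/-- The reflexive closure of the frame of the countermodel. -/
abbrev leFrame : Frame.{0} := ⟨Point, Le⟩

theorem pointFrame_validates_ax4 : pointFrame.Validates ax4 :=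
  Frame.validates_ax4.2 rel_trans

/-- A failure of U_2 yields three points with pairwise incomparable successor sets, but such points
share an index and there are only two sides. -/
theorem pointFrame_validates_axU_two : pointFrame.Validates (axU 2) := by
  intro V x
  by_contra hU
  have hax : axU 2 = disj [box (imp (box (atom 0)) (disj [box (atom 1), box (atom 2)])),
      box (imp (box (atom 1)) (disj [box (atom 0), box (atom 2)])),
      box (imp (box (atom 2)) (disj [box (atom 0), box (atom 1)]))] := rfl
  rw [hax] at hU
  simp only [truth_disj_cons, truth_disj_nil, truth_box, truth_imp, truth_atom, or_false,
    not_or, not_forall] at hU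
  obtain ⟨⟨y₀, -, h₀, ⟨z₀₁, k₀₁, l₀₁⟩, z₀₂, k₀₂, l₀₂⟩,
    ⟨y₁, -, h₁, ⟨z₁₀, k₁₀, l₁₀⟩, z₁₂, k₁₂, l₁₂⟩,
    ⟨y₂, -, h₂, ⟨z₂₀, k₂₀, l₂₀⟩, z₂₁, k₂₁, l₂₁⟩⟩ := hU
  obtain ⟨σ, n, rfl, rfl⟩ := eq_side_of_not_subset (x := y₀) (y := y₁)
    ⟨z₀₁, k₀₁, fun h => l₀₁ (h₁ _ h)⟩ ⟨z₁₀, k₁₀, fun h => l₁₀ (h₀ _ h)⟩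
  obtain ⟨τ, m, he, rfl⟩ := eq_side_of_not_subset (x := side σ n) (y := y₂)
    ⟨z₀₂, k₀₂, fun h => l₀₂ (h₂ _ h)⟩ ⟨z₂₀, k₂₀, fun h => l₂₀ (h₀ _ h)⟩
  cases he
  exact l₁₂ (h₂ _ k₁₂)

theorem truth_fineH_of_eventuallyConst {V : ℕ → Set Point} (hV : ∀ i, EventuallyConst (V i))
    (x : Point) : Truth leFrame V x fineH :=
  truth_fineH.2 fun ⟨hx, h⟩ => not_cycle (hV 6) hx h

theorem truth_fineG_of_eventuallyConst {V : ℕ → Set Point} (hV : ∀ i, EventuallyConst (V i))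
    (x : Point) : Truth leFrame V x fineG := by
  refine truth_fineG.2 fun hE => ?_
  obtain ⟨hp, h01, h10, hd, hq₁, hr₁, hq₀, hr₀, a, hxa, hA⟩ := truth_fineE.1 hE
  change Le x a at hxa
  obtain ⟨hlow, hloop⟩ := alternating (hV 0) h01 h10 hd
  obtain ⟨i, hxi, hi⟩ := hloop hp
  have hx : ∀ τ k, Le x (side τ k) := fun τ k => hxi.trans (by simp)
  obtain ⟨hap, haQ, haR, -, -⟩ := (truth_fineA 0).1 hA
  -- A 0 forbids seeing p₀, whereas chain and cluster points all see `loop i`.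
  have hal : IsLow a := by
    rcases a with ⟨σ, m⟩ | m | m | j
    · trivial
    · trivial
    · exact (hap ⟨loop i, spine_le_loop, hi⟩).elim
    · exact (hap ⟨loop i, loop_le_loop, hi⟩).elim
  obtain ⟨σ, n, mq₀, mr₀, mq₁, mr₁⟩ := exists_side_mem hq₁ hr₁ hq₀ hr₀ hxa hal haQ haR
  have nq := (hq₁ _ (hx _ _) mq₁).2
  have nr := (hr₁ _ (hx _ _) mr₁).2
  have hB₁ : ∀ y, Le x y → (Truth leFrame V y (fineB 1) ↔ y = side σ (n + 1)) := by
    refine fun y hy => ⟨fun h => ?_, fun h => h ▸ mq₁⟩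
    have := eq_side_of_mem (σ := !σ) hq₁ hq₀ hx nr mr₀ (by simpa using mq₀) hy h
    simpa using this
  have hC₁ : ∀ y, Le x y →
      (Truth leFrame V y (fineC 1) ↔ y = side (!σ) (n + 1)) :=
    fun y hy => ⟨fun h => eq_side_of_mem hr₁ hr₀ hx nq mq₀ mr₀ hy h, fun h => h ▸ mr₁⟩
  have sB₁ := fun y => exists_le_and_iff hB₁ (hx _ _) (y := y)
  have sC₁ := fun y => exists_le_and_iff hC₁ (hx _ _) (y := y)
  have hB₂ : ∀ y, Le x y →
      (Truth leFrame V y (fineB 2) ↔ y = side σ (n + 2)) := by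
    intro y hy
    refine (truth_fineB_add_two 0).trans (Iff.trans ?_ (eq_side_iff_of_not_le nq mr₀))
    exact and_congr (sB₁ y hy) (and_congr Iff.rfl (not_congr (sC₁ y hy)))
  have hC₂ : ∀ y, Le x y →
      (Truth leFrame V y (fineC 2) ↔ y = side (!σ) (n + 2)) := by
    intro y hy
    refine (truth_fineC_add_two 0).trans (Iff.trans ?_
      (eq_side_iff_of_not_le (σ := !σ) nr (by simpa using mq₀)))
    rw [Bool.not_not]
    exact and_congr (sC₁ y hy) (and_congr Iff.rfl (not_congr (sB₁ y hy)))
  have sB₂ := fun y => exists_le_and_iff hB₂ (hx _ _) (y := y)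
  have sC₂ := fun y => exists_le_and_iff hC₂ (hx _ _) (y := y)
  have hB₃ : ∀ y, Le x y →
      (Truth leFrame V y (fineB 3) ↔ y = side σ (n + 3)) := by
    intro y hy
    refine (truth_fineB_add_two 1).trans (Iff.trans ?_ (eq_side_iff (n := n + 1)))
    exact and_congr (sB₂ y hy) (and_congr (sC₁ y hy) (not_congr (sC₂ y hy)))
  have hC₃ : ∀ y, Le x y →
      (Truth leFrame V y (fineC 3) ↔ y = side (!σ) (n + 3)) := by
    intro y hy
    refine (truth_fineC_add_two 1).trans (Iff.trans ?_ (eq_side_iff (σ := !σ) (n := n + 1)))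
    rw [Bool.not_not]
    exact and_congr (sC₂ y hy) (and_congr (sB₁ y hy) (not_congr (sB₂ y hy)))
  have hA₀ : ∀ y, Le x y → Truth leFrame V y (fineA 0) → y = join n := by
    intro y hy h
    obtain ⟨-, h₁, h₂, h₃, h₄⟩ := (truth_fineA 0).1 h
    exact eq_join ((sB₁ y hy).1 h₁) ((sC₁ y hy).1 h₂) (mt (sB₂ y hy).2 h₃) (mt (sC₂ y hy).2 h₄)
  obtain rfl := hA₀ a hxa hA
  -- Only a chain point of index at most `n` sees both the cluster and `join n`.
  have hxn : Le x (spine (n + 1)) := by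
    rcases x with ⟨τ, m⟩ | m | m | j
    · exact (side_le_loop hxi).elim
    · exact (join_le_loop hxi).elim
    · exact spine_le_spine.2 ((spine_le_join.1 hxa).trans (Nat.le_succ n))
    · exact (loop_le_join hxa).elim
  have hna : Le (spine (n + 1)) (join (n + 1)) := by simp
  have hxj := hxn.trans hna
  -- One step past `n` on the chain, `join n` is out of sight but `join (n + 1)`, where A 1 holds,
  -- is not.
  refine ⟨spine (n + 1), hxn, ⟨loop i, spine_le_loop, hi⟩, ?_, join (n + 1), hna, ?_⟩
  · rintro ⟨z, hz, hzA⟩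
    obtain rfl := hA₀ z (hxn.trans hz) hzA
    exact absurd (spine_le_join.1 hz) (by omega)
  · refine (truth_fineA 1).2 ⟨?_, (sB₂ _ hxj).2 (by simp), (sC₂ _ hxj).2 (by simp), ?_, ?_⟩
    · rintro ⟨y, hy, hy0⟩
      exact hlow y (IsLow.of_le (x := join (n + 1)) trivial hy) (hxj.trans hy) hy0
    · exact fun h => absurd ((exists_le_and_iff hB₃ (hx _ _) hxj).1 h) (by simp)
    · exact fun h => absurd ((exists_le_and_iff hC₃ (hx _ _) hxj).1 h) (by simp)

/-- The valuation that refutes `¬E`. -/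
def pointValuation : ℕ → Set Point
  | 0 => {loop true}
  | 1 => {loop false}
  | 2 => {side true 0}
  | 3 => {side true 1}
  | 4 => {side false 0}
  | 5 => {side false 1}
  | _ => ∅

theorem eventuallyConst_pointValuation (i : ℕ) : EventuallyConst (pointValuation i) := by
  refine ⟨0, fun n _ => ?_⟩
  match i with
  | 0 | 1 | 2 | 3 | 4 | 5 | _ + 6 => simp [pointValuation]

/-- `join 0` sees only the indices 0 and 1 on each side, hence B 1 and C 1 but neither B 2 nor C 2.
-/
theorem truth_fineE_pointValuation :
    Truth leFrame pointValuation (spine 0) fineE := by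
  have hB : ∀ y, Le (join 0) y → ¬ Truth leFrame pointValuation y (fineB 2) := by
    intro y hy h
    obtain ⟨h₁, h₂, h₃⟩ := (truth_fineB_add_two 0).1 h
    simp only [zero_add, truth_fineB_one, truth_fineC_one, truth_fineC_zero, pointValuation,
      Set.mem_singleton_iff, exists_eq_right] at h₁ h₂ h₃
    rcases y with ⟨_ | _, k⟩ | k | k | i <;> simp at * <;> omega
  have hC : ∀ y, Le (join 0) y → ¬ Truth leFrame pointValuation y (fineC 2) := by
    intro y hy h
    obtain ⟨h₁, h₂, h₃⟩ := (truth_fineC_add_two 0).1 h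
    simp only [zero_add, truth_fineB_one, truth_fineC_one, truth_fineB_zero, pointValuation,
      Set.mem_singleton_iff, exists_eq_right] at h₁ h₂ h₃
    rcases y with ⟨_ | _, k⟩ | k | k | i <;> simp at * <;> omega
  rw [truth_fineE]
  simp only [pointValuation, Set.mem_singleton_iff, exists_eq_right]
  refine ⟨by simp, ?_, ?_, ?_, ?_, ?_, ?_, ?_, join 0, by simp, (truth_fineA 0).2 ⟨?_, ?_, ?_,
    fun ⟨y, hy, h⟩ => hB y hy h, fun ⟨y, hy, h⟩ => hC y hy h⟩⟩
  · rintro y - rfl; simp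
  · rintro y - rfl; simp
  · rintro y - ⟨rfl, h⟩; simp at h
  · rintro y - rfl; simp
  · rintro y - rfl; simp
  · rintro y - rfl; simp
  · rintro y - rfl; simp
  · simp [pointValuation]
  · exact ⟨side true 1, join_le_side.2 le_rfl, rfl⟩
  · exact ⟨side false 1, join_le_side.2 le_rfl, rfl⟩

theorem isAdmissible_pointFrame : IsAdmissible pointFrame EventuallyConst := by
  refine isAdmissible_eventuallyConst _ fun m n y hmn h => ?_
  rcases hmn.eq_or_lt with rfl | hlt
  · exact h
  · exact rel_trans _ _ _ (show Rel (spine m) (spine n) from hlt) h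

theorem isAdmissible_leFrame :
    IsAdmissible leFrame EventuallyConst :=
  isAdmissible_eventuallyConst _ fun _ _ _ hmn h => Le.trans (spine_le_spine.2 hmn) h

theorem neg_fineE_not_mem_S4GH : neg fineE ∉ S4GH := by
  intro h
  refine h _ isAdmissible_leFrame.isNormalLogic ?_ pointValuation
    eventuallyConst_pointValuation (spine 0) truth_fineE_pointValuation
  rintro φ (rfl | rfl | rfl | rfl) V hV x
  · exact Frame.validates_axT.2 Le.refl V x
  · exact Frame.validates_ax4.2 (fun _ _ _ => Le.trans) V x
  · exact truth_fineG_of_eventuallyConst hV x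
  · exact truth_fineH_of_eventuallyConst hV x

theorem neg_fineE_circ_not_mem_K4U2GHcirc : neg fineE.circ ∉ K4U2GHcirc := by
  intro h
  refine h _ isAdmissible_pointFrame.isNormalLogic ?_ pointValuation
    eventuallyConst_pointValuation (spine 0) (truth_circ.2 truth_fineE_pointValuation)
  rintro φ (rfl | rfl | rfl | rfl) V hV x
  · exact pointFrame_validates_ax4 V x
  · exact pointFrame_validates_axU_two V x
  · exact truth_circ.2 (truth_fineG_of_eventuallyConst hV x)
  · exact truth_circ.2 (truth_fineH_of_eventuallyConst hV x)

/-! ### Frames for the two logics -/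

theorem validates_neg_fineE_of_S4GH (F : Frame.{u}) (hF : F.ValidatesAll S4GH) :
    F.Validates (neg fineE) := by
  have h : ∀ φ ∈ ({axT, ax4, fineG, fineH} : Set Form), F.Validates φ :=
    fun φ hφ => hF φ (subset_normalClosure _ hφ)
  exact validates_neg_fineE (Frame.validates_axT.1 (h _ (by simp)))
    (Frame.validates_ax4.1 (h _ (by simp))) (h _ (by simp)) (h _ (by simp))

theorem validates_neg_fineE_circ_of_K4U2GHcirc (F : Frame.{u})
    (hF : F.ValidatesAll K4U2GHcirc) : F.Validates (neg fineE.circ) := by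
  have h : ∀ φ ∈ ({ax4, axU 2, fineG.circ, fineH.circ} : Set Form), F.Validates φ :=
    fun φ hφ => hF φ (subset_normalClosure _ hφ)
  have ht := Frame.validates_ax4.1 (h _ (by simp))
  refine Frame.validates_circ (φ := neg fineE).2 (validates_neg_fineE (fun _ => .inl rfl) ?_
    (Frame.validates_circ.1 (h _ (by simp))) (Frame.validates_circ.1 (h _ (by simp))))
  rintro x y z (rfl | hxy) (rfl | hyz)
  · exact .inl rfl
  · exact .inr hyz
  · exact .inr hxy
  · exact .inr (ht _ _ _ hxy hyz)

theorem finiteAchronalWidth_K4U2GHcirc : FiniteAchronalWidth K4U2GHcirc :=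
  ⟨isNormalLogic_normalClosure _, 2, two_pos, subset_normalClosure _ (by simp)⟩

theorem not_kripkeComplete_K4U2GHcirc : ¬ KripkeComplete.{u} K4U2GHcirc := fun h =>
  neg_fineE_circ_not_mem_K4U2GHcirc (h _ validates_neg_fineE_circ_of_K4U2GHcirc)

end ModalLogic

theorem mainTheorem4 :
    -- the formulas `E`, `G`, `H` witness the Kripke incompleteness of `S4GH`
    (∀ F : Frame.{u}, F.ValidatesAll S4GH → F.Validates (Form.neg fineE)) ∧
    Form.neg fineE ∉ S4GH ∧
    -- `K4U_2G°H°` is a normal extension of `K4U_2`, hence of finite achronal width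
    IsNormalLogic K4U2GHcirc ∧
    K4U 2 ⊆ K4U2GHcirc ∧
    FiniteAchronalWidth K4U2GHcirc ∧
    -- its frames validate `¬E°`, which is not one of its members
    (∀ F : Frame.{u}, F.ValidatesAll K4U2GHcirc → F.Validates (Form.neg fineE.circ)) ∧
    Form.neg fineE.circ ∉ K4U2GHcirc ∧
    -- so it is Kripke incomplete
    ¬ KripkeComplete.{u} K4U2GHcirc ∧
    -- and transitive normal logics of finite achronal width need not be Kripke complete
    ¬ (∀ L : Set Form, FiniteAchronalWidth L → ax4 ∈ L → KripkeComplete.{u} L) := by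
  refine ⟨validates_neg_fineE_of_S4GH, neg_fineE_not_mem_S4GH, isNormalLogic_normalClosure _,
    normalClosure_mono ?_, finiteAchronalWidth_K4U2GHcirc,
    validates_neg_fineE_circ_of_K4U2GHcirc, neg_fineE_circ_not_mem_K4U2GHcirc,
    not_kripkeComplete_K4U2GHcirc, fun h => not_kripkeComplete_K4U2GHcirc
      (h _ finiteAchronalWidth_K4U2GHcirc (subset_normalClosure _ (by simp)))⟩
  rintro φ (rfl | rfl) <;> simp
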